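/- Let $G$ be a finite simple graph. For a vertex $v$ let $N(v)$ be the set of neighbours of $v$ and $N[v]=N(v)\cup\{v\}$. A set $D\subseteq V(G)$ is dominating if $\bigcup_{v\in D}N[v]=V(G)$, and a set $P\subseteq V(G)$ is a packing if the sets $N[v]$, $v\in P$, are pairwise disjoint; $\gamma(G)$ denotes the minimum size of a dominating set and $\rho(G)$ the maximum size of a packing. An asteroidal triple in $G$ is a set $T$ of three pairwise non-adjacent vertices such that every two vertices of $T$ are joined by a path in $G$ that contains no vertex of the neighbourhood $N(t)$ of the third vertex $t\in T$. If $G$ contains no asteroidal triple, then $$\gamma(G)\le 3\,\rho(G).$$ -/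

import Mathlib

namespace SimpleGraph

variable {V : Type*}

/-- The closed neighbourhood `N[v]` of a vertex `v`: the vertex itself and its neighbours. -/
def closedNbhd (G : SimpleGraph V) (v : V) : Set V :=
  insert v (G.neighborSet v)

/-- A set of vertices is dominating if its closed neighbourhoods cover all the vertices. -/
def IsDominatingSet (G : SimpleGraph V) (D : Set V) : Prop :=
  ⋃ v ∈ D, G.closedNbhd v = Set.univ

/-- A set of vertices is a packing if its closed neighbourhoods are pairwise disjoint. -/
def IsPackingSet (G : SimpleGraph V) (P : Set V) : Prop :=
  P.PairwiseDisjoint G.closedNbhd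

/-- `γ(G)`: the minimum size of a dominating set (used for finite graphs only). -/
noncomputable def dominationNum (G : SimpleGraph V) : ℕ :=
  sInf {n : ℕ | ∃ D : Finset V, G.IsDominatingSet (D : Set V) ∧ D.card = n}

/-- `ρ(G)`: the maximum size of a packing (used for finite graphs only). -/
noncomputable def packingNum (G : SimpleGraph V) : ℕ :=
  sSup {n : ℕ | ∃ P : Finset V, G.IsPackingSet (P : Set V) ∧ P.card = n}

/-- An asteroidal triple: an independent set of three vertices such that every two of them are
joined by a path that avoids the neighbourhood of the third. -/
def IsAsteroidalTriple (G : SimpleGraph V) (T : Finset V) : Prop :=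
  T.card = 3 ∧ G.IsIndepSet (T : Set V) ∧
    ∀ a ∈ T, ∀ b ∈ T, ∀ c ∈ T, a ≠ b → a ≠ c → b ≠ c →
      ∃ p : G.Walk a b, p.IsPath ∧ ∀ v ∈ p.support, v ∉ G.neighborSet c

/-- A graph is asteroidal triple-free (AT-free) if it contains no asteroidal triple. -/
def IsATFree (G : SimpleGraph V) : Prop :=
  ∀ T : Finset V, ¬ G.IsAsteroidalTriple T

/-- In a finite graph the minimum defining `γ(G)` is attained. -/
theorem isLeast_dominationNum [Finite V] (G : SimpleGraph V) :
    IsLeast {n : ℕ | ∃ D : Finset V, G.IsDominatingSet (D : Set V) ∧ D.card = n}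
      G.dominationNum := by
  have := Fintype.ofFinite V
  refine ⟨Nat.sInf_mem ⟨_, Finset.univ, ?_, rfl⟩, fun n hn => Nat.sInf_le hn⟩
  refine Set.eq_univ_of_forall fun v => ?_
  simp only [Set.mem_iUnion]
  exact ⟨v, by simp, Set.mem_insert v _⟩

/-- In a finite graph the maximum defining `ρ(G)` is attained. -/
theorem isGreatest_packingNum [Finite V] (G : SimpleGraph V) :
    IsGreatest {n : ℕ | ∃ P : Finset V, G.IsPackingSet (P : Set V) ∧ P.card = n}
      G.packingNum := by
  have := Fintype.ofFinite V
  have hb : BddAbove {n : ℕ | ∃ P : Finset V, G.IsPackingSet (P : Set V) ∧ P.card = n} := by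
    refine ⟨Fintype.card V, ?_⟩
    rintro n ⟨P, -, rfl⟩
    exact P.card_le_univ
  refine ⟨Nat.sSup_mem ⟨0, ∅, ?_, rfl⟩ hb, fun n hn => le_csSup hb hn⟩
  simp [IsPackingSet]

end SimpleGraph

namespace SimpleGraph

variable {V : Type*}

/-! Each component has a dominating pair `x`, `y`: every `x`–`y` walk dominates the component
(`exists_dominating_pair`). A shortest such path, of length `ℓ`, gives `ℓ + 1` dominating vertices,
and every third one gives a packing of size `ℓ / 3 + 1`; unions over the components finish. The pair
comes from two extremal choices: `x` maximizes `missWeight`, then `y` maximizes the number of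
vertices whose closed neighbourhoods meet all `x`–`y` walks. -/

theorem mem_closedNbhd_comm {G : SimpleGraph V} {a b : V} :
    a ∈ G.closedNbhd b ↔ b ∈ G.closedNbhd a := by
  simp [closedNbhd, eq_comm, G.adj_comm]

theorem self_mem_closedNbhd (G : SimpleGraph V) (a : V) : a ∈ G.closedNbhd a :=
  Set.mem_insert _ _

/-- Some walk from `a` to `b` avoids the closed neighbourhood of `c`. -/
def Misses (G : SimpleGraph V) (c a b : V) : Prop :=
  ∃ p : G.Walk a b, ∀ v ∈ p.support, v ∉ G.closedNbhd c

namespace Misses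

variable {G : SimpleGraph V} {a b c d : V}

theorem refl (h : a ∉ G.closedNbhd c) : G.Misses c a a :=
  ⟨.nil, by simpa using h⟩

theorem symm : G.Misses c a b → G.Misses c b a := fun ⟨p, hp⟩ =>
  ⟨p.reverse, by simpa using hp⟩

theorem trans : G.Misses c a b → G.Misses c b d → G.Misses c a d := fun ⟨p, hp⟩ ⟨q, hq⟩ =>
  ⟨p.append q, fun v hv => (Walk.mem_support_append_iff p q).1 hv |>.elim (hp v) (hq v)⟩

theorem left_notMem : G.Misses c a b → a ∉ G.closedNbhd c := fun ⟨p, hp⟩ => hp _ p.start_mem_support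

theorem right_notMem (h : G.Misses c a b) : b ∉ G.closedNbhd c := h.symm.left_notMem

theorem reachable : G.Misses c a b → G.Reachable a b := fun ⟨p, _⟩ => ⟨p⟩

theorem of_mem_closedNbhd (ha : a ∉ G.closedNbhd c) (hb : b ∉ G.closedNbhd c)
    (hab : b ∈ G.closedNbhd a) : G.Misses c a b := by
  rcases hab with rfl | hab
  · exact refl hb
  · have hab : G.Adj a b := hab
    refine ⟨.cons hab .nil, ?_⟩
    simp [ha, hb]

/-- A walk that avoids `N[c]` either avoids `N[d]` as well or has a vertex of `N[d]` that can be
reached from its start. -/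
theorem or_exists (h : G.Misses c a b) (d : V) :
    G.Misses d a b ∨ ∃ t ∈ G.closedNbhd d, G.Misses c a t := by
  classical
  obtain ⟨p, hp⟩ := h
  by_cases H : ∀ v ∈ p.support, v ∉ G.closedNbhd d
  · exact .inl ⟨p, H⟩
  · push Not at H
    obtain ⟨t, ht, htd⟩ := H
    exact .inr ⟨t, htd, p.takeUntil t ht, fun v hv => hp v (p.support_takeUntil_subset_support ht hv)⟩

end Misses

theorem IsATFree.not_misses {G : SimpleGraph V} (hG : G.IsATFree) {a b c : V}
    (hab : G.Misses c a b) (hac : G.Misses b a c) : ¬ G.Misses a b c := by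
  classical
  intro hbc
  have key : ∀ {x y z : V}, G.Misses z x y →
      ∃ p : G.Walk x y, p.IsPath ∧ ∀ v ∈ p.support, v ∉ G.neighborSet z := by
    rintro x y z ⟨p, hp⟩
    exact ⟨p.bypass, p.bypass_isPath, fun v hv hz =>
      hp v (p.support_bypass_subset_support hv) (Set.mem_insert_of_mem _ hz)⟩
  have h1 := hab.left_notMem
  have h2 := hab.right_notMem
  have h3 := hac.left_notMem
  simp only [closedNbhd, Set.mem_insert_iff, mem_neighborSet, not_or] at h1 h2 h3
  refine hG {a, b, c} ⟨Finset.card_eq_three.2 ⟨a, b, c, h3.1, h1.1, h2.1, rfl⟩, ?_, ?_⟩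
  · have h1' := mt Adj.symm h1.2
    have h2' := mt Adj.symm h2.2
    have h3' := mt Adj.symm h3.2
    intro x hx y hy hxy
    simp only [Finset.coe_insert, Finset.coe_singleton, Set.mem_insert_iff,
      Set.mem_singleton_iff] at hx hy
    rcases hx with rfl | rfl | rfl <;> rcases hy with rfl | rfl | rfl <;> tauto
  · intro x hx y hy z hz hxy hxz hyz
    simp only [Finset.mem_insert, Finset.mem_singleton] at hx hy hz
    apply key
    rcases hx with rfl | rfl | rfl <;> rcases hy with rfl | rfl | rfl <;>
      rcases hz with rfl | rfl | rfl <;>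
      first
      | contradiction
      | assumption
      | (apply Misses.symm; assumption)

/-- The size of the component of `p` after the removal of `N[a]`, and `0` if `p ∈ N[a]`. -/
noncomputable def missCard (G : SimpleGraph V) (a p : V) : ℕ :=
  {q | G.Misses a p q}.ncard

/-- A weight that dominates the lexicographic order on the component sizes of `G - N[a]`. -/
noncomputable def missWeight [Fintype V] (G : SimpleGraph V) (a : V) : ℕ :=
  ∑ p, (G.missCard a p + 1).factorial

/-- AT-freeness puts `u` and `v` in different components of `G - N[a]`. Passing to `G - N[v]` can
break only the component of `v`, while that of `u`, no smaller, survives and is joined to `a`. -/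
theorem missWeight_lt [Fintype V] {G : SimpleGraph V} (hG : G.IsATFree) {a u v : V}
    (hu : G.Misses v a u) (hv : G.Misses u a v) (hle : G.missCard a v ≤ G.missCard a u) :
    G.missWeight a < G.missWeight v := by
  classical
  have huv : ¬ G.Misses a u v := hG.not_misses hu hv
  have hva : v ∉ G.closedNbhd a := mt mem_closedNbhd_comm.1 hu.left_notMem
  have hua : u ∉ G.closedNbhd a := mt mem_closedNbhd_comm.1 hv.left_notMem
  have transfer : ∀ {p q : V}, ¬ G.Misses a v p → G.Misses a p q → G.Misses v p q := by
    intro p q hp hpq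
    rcases hpq.or_exists v with h | ⟨t, ht, hpt⟩
    · exact h
    · exact absurd ((Misses.of_mem_closedNbhd hva hpt.right_notMem ht).trans hpt.symm) hp
  have hav : ¬ G.Misses a v a := fun h => h.right_notMem (G.self_mem_closedNbhd a)
  have ha0 : G.missCard a a = 0 := by
    rw [missCard, Set.ncard_eq_zero]
    exact Set.eq_empty_of_forall_notMem fun q hq => hq.left_notMem (G.self_mem_closedNbhd a)
  have ha1 : G.missCard a v + 1 ≤ G.missCard v a := by
    refine (Nat.add_le_add_right hle 1).trans ?_
    have hn : a ∉ {q | G.Misses a u q} := fun h => h.right_notMem (G.self_mem_closedNbhd a)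
    rw [missCard, ← Set.ncard_insert_of_notMem hn]
    refine Set.ncard_le_ncard (Set.insert_subset (Misses.refl hu.left_notMem) fun q hq => ?_)
    exact hu.trans (transfer (fun h => huv h.symm) hq)
  have hC : ∀ p, G.Misses a v p → G.missCard a p = G.missCard a v := by
    intro p hp
    refine congrArg Set.ncard (Set.ext fun q => ⟨hp.trans, hp.symm.trans⟩)
  set c := G.missCard a v with hc
  -- The `c` vertices in the component of `v` lose at most `(c + 1)!` each; `a` alone gains at least
  -- `(c + 2)! - 1`, which exceeds `c * (c + 1)!`.
  have hpoint : ∀ p, (G.missCard a p + 1).factorial + (if p = a then (c + 2).factorial - 1 else 0) ≤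
      (G.missCard v p + 1).factorial + (if G.Misses a v p then (c + 1).factorial else 0) := by
    intro p
    by_cases hpa : p = a
    · subst hpa
      have := Nat.factorial_le (Nat.add_le_add_right ha1 1)
      have h1 := Nat.factorial_pos (c + 2)
      simp only [ha0, if_true, if_neg hav, zero_add, Nat.factorial_one]
      rw [show c + 1 + 1 = c + 2 from rfl] at this
      omega
    · by_cases hp : G.Misses a v p
      · simp [hpa, hp, hC p hp]
      · simp only [hpa, hp, if_false, add_zero]
        exact Nat.factorial_le (Nat.add_le_add_right
          (Set.ncard_le_ncard fun q hq => transfer hp hq) 1)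
  have hsum := Finset.sum_le_sum fun p (_ : p ∈ Finset.univ) => hpoint p
  rw [Finset.sum_add_distrib, Finset.sum_add_distrib, Finset.sum_ite_eq' Finset.univ a,
    ← Finset.sum_filter, Finset.sum_const, smul_eq_mul] at hsum
  have hcard : (Finset.univ.filter fun p => G.Misses a v p).card = c := by
    rw [hc, missCard, ← Set.ncard_coe_finset]
    simp
  rw [hcard] at hsum
  simp only [Finset.mem_univ, if_true] at hsum
  have h2 : (c + 2).factorial = (c + 2) * (c + 1).factorial := Nat.factorial_succ (c + 1)
  have h3 := Nat.factorial_pos (c + 1)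
  rw [add_mul] at h2
  unfold missWeight
  omega

/-- In a finite AT-free graph every component has a vertex with respect to which no two vertices
are unrelated. -/
theorem IsATFree.exists_no_unrelated [Finite V] {G : SimpleGraph V} (hG : G.IsATFree) (r : V) :
    ∃ x, G.Reachable r x ∧ ∀ u v, G.Misses v x u → ¬ G.Misses u x v := by
  have := Fintype.ofFinite V
  obtain ⟨x, hx, hmax⟩ := Set.exists_max_image {x | G.Reachable r x} G.missWeight
    (Set.toFinite _) ⟨r, Reachable.refl r⟩
  refine ⟨x, hx, fun u v hu hv => ?_⟩
  rcases le_total (G.missCard x v) (G.missCard x u) with h | h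
  · exact (missWeight_lt hG hu hv h).not_ge (hmax v (hx.trans hv.reachable))
  · exact (missWeight_lt hG hv hu h).not_ge (hmax u (hx.trans hu.reachable))

/-- Every component of a finite AT-free graph has a dominating pair. -/
theorem IsATFree.exists_dominating_pair [Finite V] {G : SimpleGraph V} (hG : G.IsATFree) (r : V) :
    ∃ x y, G.Reachable r x ∧ G.Reachable x y ∧ ∀ z, G.Reachable r z → ¬ G.Misses z x y := by
  obtain ⟨x, hrx, hx⟩ := hG.exists_no_unrelated r
  obtain ⟨y, hy, hmax⟩ := Set.exists_max_image {y | G.Reachable x y}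
    (fun y => {w | ¬ G.Misses w x y}.ncard) (Set.toFinite _) ⟨x, Reachable.refl x⟩
  refine ⟨x, y, hrx, hy, fun z hz hzy => ?_⟩
  -- If a walk from `x` to `y` missed `z`, then `z` would beat `y`: its set gains `z`. A lost `w`
  -- would make `z` unrelated to `y` or to `w`, or yield an `x`–`y` walk missing `w`.
  refine (Set.ncard_lt_ncard ((Set.ssubset_iff_of_subset fun w hw hwz => ?_).2
    ⟨z, fun h => h.right_notMem (G.self_mem_closedNbhd z), not_not_intro hzy⟩)).not_ge
    (hmax z (hrx.symm.trans hz))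
  rcases hwz.or_exists y with h | ⟨t, ht, hxt⟩
  · exact hx z y h hzy
  · by_cases hyw : y ∈ G.closedNbhd w
    · refine hx w z (hzy.trans (Misses.of_mem_closedNbhd hzy.right_notMem ?_ ?_)) hwz
      · exact mt mem_closedNbhd_comm.1 hwz.right_notMem
      · exact mem_closedNbhd_comm.1 hyw
    · exact hw (hxt.trans (Misses.of_mem_closedNbhd hxt.right_notMem hyw
        (mem_closedNbhd_comm.1 ht)))

theorem reachable_of_mem_closedNbhd {G : SimpleGraph V} {a b : V} (h : b ∈ G.closedNbhd a) :
    G.Reachable a b := by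
  rcases h with rfl | h
  · exact Reachable.refl _
  · exact Adj.reachable h

theorem dist_le_succ_of_mem_closedNbhd {G : SimpleGraph V} {x a b : V} (hx : G.Reachable x a)
    (h : b ∈ G.closedNbhd a) : G.dist x b ≤ G.dist x a + 1 := by
  rcases h with rfl | h
  · exact Nat.le_succ _
  · obtain ⟨p, hp⟩ := hx.exists_walk_length_eq_dist
    rw [← hp]
    exact (dist_le (p.concat h)).trans (p.length_concat h).le

theorem Walk.dist_getVert_of_length_eq_dist {G : SimpleGraph V} {x y : V} (p : G.Walk x y)
    (hp : p.length = G.dist x y) {i : ℕ} (hi : i ≤ p.length) : G.dist x (p.getVert i) = i := by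
  apply le_antisymm
  · exact (dist_le (p.take i)).trans (by simp)
  · obtain ⟨q, hq⟩ := (p.take i).reachable.exists_walk_length_eq_dist
    have := dist_le (q.append (p.drop i))
    simp only [Walk.length_append, Walk.drop_length] at this
    omega

/-- A component of a finite AT-free graph has a dominating set and a packing with sizes of ratio at
most three. -/
theorem IsATFree.exists_dominating_packing [Finite V] {G : SimpleGraph V} (hG : G.IsATFree)
    (r : V) : ∃ D P : Finset V, (∀ z, G.Reachable r z → ∃ v ∈ D, z ∈ G.closedNbhd v) ∧
      (∀ v ∈ P, G.Reachable r v) ∧ G.IsPackingSet (P : Set V) ∧ D.card ≤ 3 * P.card := by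
  classical
  obtain ⟨x, y, hrx, hxy, hdom⟩ := hG.exists_dominating_pair r
  obtain ⟨p, hp⟩ := hxy.exists_walk_length_eq_dist
  have hdist : ∀ i ∈ Finset.range (p.length / 3 + 1), G.dist x (p.getVert (3 * i)) = 3 * i := by
    intro i hi
    rw [Finset.mem_range] at hi
    exact p.dist_getVert_of_length_eq_dist hp (by omega)
  refine ⟨p.support.toFinset, (Finset.range (p.length / 3 + 1)).image fun i => p.getVert (3 * i),
    fun z hz => ?_, ?_, ?_, ?_⟩
  · by_contra! H
    exact hdom z hz ⟨p, fun v hv h => H v (by simpa using hv) (mem_closedNbhd_comm.1 h)⟩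
  · simp only [Finset.mem_image]
    rintro _ ⟨i, -, rfl⟩
    exact hrx.trans (p.take _).reachable
  -- A common `z` forces `3 * i ≤ 3 * j + 2` by distances from `x`.
  · have key : ∀ i ∈ Finset.range (p.length / 3 + 1), ∀ j ∈ Finset.range (p.length / 3 + 1),
        ∀ z ∈ G.closedNbhd (p.getVert (3 * i)), z ∈ G.closedNbhd (p.getVert (3 * j)) → i ≤ j := by
      intro i hi j hj z hzi hzj
      have hj' := (p.take (3 * j)).reachable
      have h1 := dist_le_succ_of_mem_closedNbhd hj' hzj
      have h2 := dist_le_succ_of_mem_closedNbhd (hj'.trans (reachable_of_mem_closedNbhd hzj))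
        (mem_closedNbhd_comm.1 hzi)
      rw [hdist i hi] at h2
      rw [hdist j hj] at h1
      omega
    intro a ha b hb hab
    simp only [Finset.coe_image, Set.mem_image, Finset.mem_coe] at ha hb
    obtain ⟨i, hi, rfl⟩ := ha
    obtain ⟨j, hj, rfl⟩ := hb
    refine Set.disjoint_left.2 fun z hzi hzj => hab ?_
    rw [le_antisymm (key i hi j hj z hzi hzj) (key j hj i hi z hzj hzi)]
  · rw [Finset.card_image_of_injOn, Finset.card_range]
    · refine (List.toFinset_card_le _).trans ?_
      rw [Walk.length_support]
      omega
    · intro i hi j hj hij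
      have h1 := hdist i hi
      have h2 := hdist j hj
      simp only at hij
      rw [hij] at h1
      omega

theorem IsATFree.exists_dominatingSet_packingSet [Finite V] {G : SimpleGraph V} (hG : G.IsATFree) :
    ∃ D P : Finset V, G.IsDominatingSet (D : Set V) ∧ G.IsPackingSet (P : Set V) ∧
      D.card ≤ 3 * P.card := by
  classical
  have := Fintype.ofFinite V
  choose D P hD hPr hP hDP using fun c : G.ConnectedComponent =>
    hG.exists_dominating_packing c.exists_rep.choose
  have hrep : ∀ c : G.ConnectedComponent, G.connectedComponentMk c.exists_rep.choose = c :=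
    fun c => c.exists_rep.choose_spec
  have hcomp : ∀ c, ∀ v ∈ P c, G.connectedComponentMk v = c := fun c v hv =>
    (ConnectedComponent.sound (hPr c v hv)).symm.trans (hrep c)
  refine ⟨Finset.univ.biUnion D, Finset.univ.biUnion P, ?_, ?_, ?_⟩
  · refine Set.eq_univ_of_forall fun z => ?_
    obtain ⟨v, hv, hz⟩ := hD (G.connectedComponentMk z) z (ConnectedComponent.exact (hrep _))
    simp only [Set.mem_iUnion]
    exact ⟨v, by simpa using ⟨_, hv⟩, hz⟩
  · intro a ha b hb hab
    simp only [Finset.coe_biUnion, Set.mem_iUnion, Finset.mem_coe] at ha hb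
    obtain ⟨c, -, ha⟩ := ha
    obtain ⟨d, -, hb⟩ := hb
    refine Set.disjoint_left.2 fun z hza hzb => ?_
    have hcd : c = d := by
      rw [← hcomp c a ha, ← hcomp d b hb]
      exact ConnectedComponent.sound ((reachable_of_mem_closedNbhd hza).trans
        (reachable_of_mem_closedNbhd hzb).symm)
    subst hcd
    exact Set.disjoint_left.1 (hP c ha hb hab) hza hzb
  · rw [Finset.card_biUnion (s := Finset.univ) (t := P), Finset.mul_sum]
    · exact Finset.card_biUnion_le.trans (Finset.sum_le_sum fun c _ => hDP c)
    · intro c _ d _ hcd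
      refine Finset.disjoint_left.2 fun v hc hd => hcd ?_
      rw [← hcomp c v hc, ← hcomp d v hd]

end SimpleGraph

theorem mainTheorem5 {V : Type*} [Finite V] (G : SimpleGraph V) (hG : G.IsATFree) :
    G.dominationNum ≤ 3 * G.packingNum := by
  obtain ⟨D, P, hD, hP, h⟩ := hG.exists_dominatingSet_packingSet
  exact (G.isLeast_dominationNum.2 ⟨D, hD, rfl⟩).trans
    (h.trans (Nat.mul_le_mul_left 3 (G.isGreatest_packingNum.2 ⟨P, hP, rfl⟩)))
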